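/- Let $s,t>1$ be coprime integers. A partition $\lambda=(\lambda_1\ge\lambda_2\ge\cdots)$ has beta-set $\beta(\lambda)=\{\lambda_r-r : r\ge 1\}$. Its rim consists of the nodes $(r,c)$ of its Young diagram such that $(r+1,c+1)$ is not a node; a rim $s$-hook is a connected set of $s$ nodes of the rim whose removal leaves a Young diagram. An $s$-core is a partition with no rim $s$-hook, the $s$-core of $\lambda$ is the partition reached by removing rim $s$-hooks until none remain, and the $s$-weight of $\lambda$ is the number of rim $s$-hooks removed. An $(s,t)$-core is a partition that is both an $s$-core and a $t$-core. Let $\sigma,\tau$ be $(s,t)$-cores. Let $\mathcal M_{\sigma,\tau}$ be the set of $(s,t)$-minimal partitions with cores $\sigma,\tau$, i.e. the partitions of smallest size among those with $s$-core $\sigma$ and $t$-core $\tau$, and let $m_{\sigma,\tau}$ be their common size. For $i\in\mathbb Z/s\mathbb Z$ put \[ \delta_i=\tfrac1s\bigl(\max(\beta(\sigma)\cap i)-\max(\beta(\tau)\cap i)\bigr), \] and write $\delta_a=\delta_{a+s\mathbb Z}$ for $a\in\mathbb Z$. An integer $x$ is a peak for $\sigma,\tau$ if $x=\max(\beta(\tau)\cap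 y)$, where $y=kt+s\mathbb Z$ with $0\le k<s$ is chosen so that $\delta_0+\delta_t+\delta_{2t}+\cdots+\delta_{kt}$ is maximal. If $x$ is a peak for $\sigma,\tau$, then $\mathcal M_{\sigma,\tau}$ is non-empty, and every partition in $\mathcal M_{\sigma,\tau}$ has $t$-weight \[ w=\delta_{x+t}+2\delta_{x+2t}+\cdots+(s-1)\delta_{x+(s-1)t}+s\delta_x . \] Consequently $m_{\sigma,\tau}=|\tau|+t\,w$. -/

import Mathlib

/-! Partitions are Mathlib's Young diagrams: the node in row `i` and column `j` (counted from `0`)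
is `(i, j)`, and `lam.rowLen i` is the part with index `i + 1`. -/

namespace CoreTheory

/-- Two nodes are adjacent if they share an edge: `(i, j)` and `(i', j')` are related by the
covering relation of the product order on `ℕ × ℕ`. -/
def nodeGraph : SimpleGraph (ℕ × ℕ) := SimpleGraph.hasse (ℕ × ℕ)

/-- The rim: the nodes `(r, c)` such that `(r + 1, c + 1)` is not a node. -/
def rim (lam : YoungDiagram) : Set (ℕ × ℕ) :=
  {c | c ∈ lam ∧ (c.1 + 1, c.2 + 1) ∉ lam}

/-- `mu` is obtained from `lam` by removing a rim `s`-hook, i.e. a connected set of `s` nodes of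
the rim of `lam` whose removal leaves a Young diagram (that of `mu`). -/
def RemovesRimHook (s : ℕ) (lam mu : YoungDiagram) : Prop :=
  ∃ H : Finset (ℕ × ℕ), (H : Set (ℕ × ℕ)) ⊆ rim lam ∧ H.card = s ∧
    (nodeGraph.induce (H : Set (ℕ × ℕ))).Connected ∧ mu.cells = lam.cells \ H

/-- An `s`-core is a partition without rim `s`-hooks. -/
def IsCore (s : ℕ) (lam : YoungDiagram) : Prop :=
  ∀ mu : YoungDiagram, ¬ RemovesRimHook s lam mu

/-- `RemovesRimHooks s w lam mu`: `mu` is obtained from `lam` by successively removing exactly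
`w` rim `s`-hooks. -/
inductive RemovesRimHooks (s : ℕ) : ℕ → YoungDiagram → YoungDiagram → Prop
  | refl (lam : YoungDiagram) : RemovesRimHooks s 0 lam lam
  | step {w : ℕ} {lam mu nu : YoungDiagram} :
      RemovesRimHook s lam mu → RemovesRimHooks s w mu nu → RemovesRimHooks s (w + 1) lam nu

/-- `sig` is the `s`-core of `lam`: rim `s`-hooks are removed until none remain. -/
def HasCore (s : ℕ) (lam sig : YoungDiagram) : Prop :=
  IsCore s sig ∧ ∃ w : ℕ, RemovesRimHooks s w lam sig

/-- `w` is the `s`-weight of `lam`: the number of rim `s`-hooks removed to reach the `s`-core. -/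
def HasWeight (s : ℕ) (lam : YoungDiagram) (w : ℕ) : Prop :=
  ∃ sig : YoungDiagram, IsCore s sig ∧ RemovesRimHooks s w lam sig

/-- An `(s,t)`-core is both an `s`-core and a `t`-core. -/
def IsSTCore (s t : ℕ) (lam : YoungDiagram) : Prop :=
  IsCore s lam ∧ IsCore t lam

/-- The partitions with `s`-core `sig` and `t`-core `tau`. -/
def withCores (s t : ℕ) (sig tau : YoungDiagram) : Set YoungDiagram :=
  {lam | HasCore s lam sig ∧ HasCore t lam tau}

/-- The `(s,t)`-minimal partitions with `s`-core `sig` and `t`-core `tau`: no partition with the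
same `s`-core and `t`-core is smaller. -/
def minimalPartitions (s t : ℕ) (sig tau : YoungDiagram) : Set YoungDiagram :=
  {lam | lam ∈ withCores s t sig tau ∧ ∀ mu ∈ withCores s t sig tau, lam.card ≤ mu.card}

/-- The beta-set of a partition: all `lam_r - r` for `r = i + 1 ≥ 1`. -/
def betaSet (lam : YoungDiagram) : Set ℤ :=
  {b | ∃ i : ℕ, b = (lam.rowLen i : ℤ) - ((i : ℤ) + 1)}

/-- The largest element of the beta-set in the class `i` modulo `s`. For `s ≥ 1` the set is
non-empty and bounded above, so the supremum is a maximum. -/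
noncomputable def maxBeta (s : ℕ) (lam : YoungDiagram) (i : ZMod s) : ℤ :=
  sSup {b : ℤ | b ∈ betaSet lam ∧ (b : ZMod s) = i}

/-- `δ_i = (max (β(sig) ∩ i) - max (β(tau) ∩ i)) / s`; the two maxima are congruent modulo `s`,
so the division is exact. -/
noncomputable def delta (s : ℕ) (sig tau : YoungDiagram) (i : ZMod s) : ℤ :=
  (maxBeta s sig i - maxBeta s tau i) / (s : ℤ)

/-- The sum `δ_0 + δ_t + δ_{2t} + ⋯ + δ_{kt}`. -/
noncomputable def deltaSum (s t : ℕ) (sig tau : YoungDiagram) (k : ℕ) : ℤ :=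
  ∑ j ∈ Finset.range (k + 1), delta s sig tau ((j * t : ℕ) : ZMod s)

/-- `x` is a peak for `sig`, `tau`: `x = max (β(tau) ∩ y)` for a class `y` modulo `s` that
maximises `δ_0 + δ_t + δ_{2t} + ⋯ + δ_y`. As `t` is prime to `s`, each class is `kt + sℤ` for
exactly one `k` with `0 ≤ k < s`. -/
def IsPeak (s t : ℕ) (sig tau : YoungDiagram) (x : ℤ) : Prop :=
  ∃ k : ℕ, k < s ∧
    (∀ l : ℕ, l < s → deltaSum s t sig tau l ≤ deltaSum s t sig tau k) ∧
    x = maxBeta s tau ((k * t : ℕ) : ZMod s)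

/-- `δ_{x+t} + 2 δ_{x+2t} + ⋯ + (s-1) δ_{x+(s-1)t} + s δ_x`. -/
noncomputable def peakWeight (s t : ℕ) (sig tau : YoungDiagram) (x : ℤ) : ℤ :=
  (∑ i ∈ Finset.Ico 1 s, (i : ℤ) * delta s sig tau ((x + (i : ℤ) * (t : ℤ) : ℤ) : ZMod s))
    + (s : ℤ) * delta s sig tau (x : ZMod s)

/-- The common size of the `(s,t)`-minimal partitions with cores `sig` and `tau`: the least size
of a partition with these cores. -/
noncomputable def minimalSize (s t : ℕ) (sig tau : YoungDiagram) : ℕ :=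
  sInf (YoungDiagram.card '' withCores s t sig tau)

end CoreTheory

/-! Encode a partition by its beta-set, viewed as beads on the integers. Removing a rim `h`-hook is
moving one bead `h` places left into a gap (`RemovesRimHook.exists_bead`, `exists_removesRimHook`).
Let the charge `c_i` be the number of beads in the class `i` modulo `h`, relative to the empty
partition. Removing `h`-hooks preserves these charges, and an `h`-core is determined by them. So
having cores `sig` and `tau` means having the `s`-charges of `sig` and the `t`-charges of `tau`
(`hasCore_iff`), with no further mention of hooks.

Lower bound. Consider the moment `M = c_{x+t} + 2 c_{x+2t} + ⋯ + s c_{x+st}`, with charges modulo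
`s`. Adding a rim `t`-hook moves a bead from a class `x + jt` to `x + (j+1)t`, where `1 ≤ j ≤ s`.
This raises `M` by one, except that it lowers `M` by `s - 1` if `j = s`. Hence the `t`-weight is at
least `M(sig) - M(tau)`, which is the asserted weight because differences of charges of `s`-cores
are the `δ_i`. This bound holds for every `x`.

Attainment. At a peak the partial sums of `δ_{x+t}, δ_{x+2t}, …` are nonpositive, so along this list
of classes `tau` has its surplus of beads, compared with `sig`, before its deficit. Surplus beads
can therefore be moved right by multiples `dt` without leaving the class `x`. Each such move keeps
the `t`-charges, adds `dt` nodes and raises `M` by exactly `d`, so the bound is met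
(`exists_charge_eq`). A free target exists since `sig`, being a `t`-core, has a beta-set closed
under subtracting `dt` (`exists_movable_bead`). -/

namespace CoreTheory

/-! ### Diagonal lengths and the beta-set -/

/-- The content `j - i` of the node `(i, j)`. -/
def content (p : ℕ × ℕ) : ℤ := (p.2 : ℤ) - (p.1 : ℤ)

/-- The number of nodes of content `c`. -/
def diag (lam : YoungDiagram) (c : ℤ) : ℤ := ((lam.cells.filter fun p => content p = c).card : ℤ)

theorem diag_nonneg (lam : YoungDiagram) (c : ℤ) : 0 ≤ diag lam c := by
  unfold diag; positivity

theorem eq_of_content_eq_of_min_eq {p q : ℕ × ℕ} (h : content p = content q)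
    (h' : min p.1 p.2 = min q.1 q.2) : p = q := by
  unfold content at h
  ext <;> omega

/-- The nodes of a given content form an initial segment of the diagonal. -/
theorem mem_iff_min_lt_diag (lam : YoungDiagram) (p : ℕ × ℕ) :
    p ∈ lam ↔ ((min p.1 p.2 : ℕ) : ℤ) < diag lam (content p) := by
  unfold diag
  rw [Nat.cast_lt]
  constructor
  · intro hp
    have hsub : (Finset.range (min p.1 p.2 + 1)).image (fun k => (p.1 - k, p.2 - k)) ⊆
        lam.cells.filter fun q => content q = content p := by
      intro q hq
      simp only [Finset.mem_image, Finset.mem_range] at hq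
      obtain ⟨k, hk, rfl⟩ := hq
      simp only [Finset.mem_filter, YoungDiagram.mem_cells]
      refine ⟨lam.up_left_mem (Nat.sub_le _ _) (Nat.sub_le _ _) hp, ?_⟩
      unfold content
      dsimp only
      omega
    have hc := Finset.card_le_card hsub
    rw [Finset.card_image_of_injOn, Finset.card_range] at hc
    · omega
    · intro a ha b hb hab
      simp only [Finset.coe_range, Set.mem_Iio] at ha hb
      simp only [Prod.mk.injEq] at hab
      omega
  · intro h
    by_contra hp
    have : (lam.cells.filter fun q => content q = content p).card ≤
        (Finset.range (min p.1 p.2)).card := by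
      refine Finset.card_le_card_of_injOn (fun q => min q.1 q.2) ?_ ?_
      · intro q hq
        simp only [Finset.coe_filter, Set.mem_ofPred_eq, YoungDiagram.mem_cells] at hq
        simp only [Finset.coe_range, Set.mem_Iio]
        by_contra hlt
        apply hp
        have h1 := hq.2
        unfold content at h1
        exact lam.up_left_mem (i2 := q.1) (j2 := q.2) (by omega) (by omega) hq.1
      · intro q hq r hr hqr
        simp only [Finset.coe_filter, Set.mem_ofPred_eq] at hq hr
        exact eq_of_content_eq_of_min_eq (hq.2.trans hr.2.symm) hqr
    rw [Finset.card_range] at this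
    omega

theorem eq_of_diag_eq {lam mu : YoungDiagram} (h : ∀ c, diag lam c = diag mu c) : lam = mu := by
  ext p
  rw [YoungDiagram.mem_cells, YoungDiagram.mem_cells, mem_iff_min_lt_diag, mem_iff_min_lt_diag, h]

open Classical in
/-- The indicator function of the beta-set. -/
noncomputable def ind (lam : YoungDiagram) (c : ℤ) : ℤ := if c ∈ betaSet lam then 1 else 0

theorem mem_betaSet_natCast (lam : YoungDiagram) (k : ℕ) :
    (k : ℤ) ∈ betaSet lam ↔ ∃ i, (i, i + k) ∈ lam ∧ (i, i + k + 1) ∉ lam := by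
  unfold betaSet
  simp only [Set.mem_ofPred_eq, YoungDiagram.mem_iff_lt_rowLen]
  refine exists_congr fun i => ?_
  omega

theorem mem_betaSet_negSucc (lam : YoungDiagram) (k : ℕ) :
    (-(k : ℤ) - 1) ∈ betaSet lam ↔
      ∃ m, (m + k, m) ∉ lam ∧ (m = 0 ∨ (m + k, m - 1) ∈ lam) := by
  unfold betaSet
  simp only [Set.mem_ofPred_eq, YoungDiagram.mem_iff_lt_rowLen]
  constructor
  · rintro ⟨i, hi⟩
    -- The row `i` has length `i - k`, so the truncated subtraction is exact.
    refine ⟨i - k, ?_⟩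
    have : i - k + k = i := by omega
    rw [this]
    omega
  · rintro ⟨m, hm⟩
    exact ⟨m + k, by omega⟩

/-- Consecutive diagonals differ in length by at most one, and a bead at `c` records that a row ends
there. The correction for `c < 0` is the beta-set of the empty partition. This identity is the
bridge between nodes and beads. -/
theorem diag_sub_diag_succ (lam : YoungDiagram) (c : ℤ) :
    diag lam c - diag lam (c + 1) = ind lam c - if c < 0 then 1 else 0 := by
  have hm := fun i j => mem_iff_min_lt_diag lam (i, j)
  simp only [content] at hm
  obtain ⟨n, hn⟩ := Int.eq_ofNat_of_zero_le (diag_nonneg lam c)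
  obtain ⟨n', hn'⟩ := Int.eq_ofNat_of_zero_le (diag_nonneg lam (c + 1))
  unfold ind
  rw [hn, hn']
  rcases lt_or_ge c 0 with hc | hc
  · obtain ⟨k, hk⟩ : ∃ k : ℕ, c = -(k : ℤ) - 1 := ⟨(-c - 1).toNat, by omega⟩
    have h1 : ∀ i, (i + k + 1, i) ∈ lam ↔ i < n := by
      intro i
      rw [hm, show (i : ℤ) - ((i + k + 1 : ℕ) : ℤ) = c by push_cast; omega, hn]
      omega
    have h2 : ∀ i, (i + k, i) ∈ lam ↔ i < n' := by
      intro i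
      rw [hm, show (i : ℤ) - ((i + k : ℕ) : ℤ) = c + 1 by push_cast; omega, hn']
      omega
    have h3 : ∀ m, m ≠ 0 → ((m + k, m - 1) ∈ lam ↔ m - 1 < n) := by
      intro m hm0
      rw [← h1 (m - 1), show m - 1 + k + 1 = m + k by omega]
    have h4 : n ≤ n' := by
      by_contra hlt
      have := lam.up_left_mem (Nat.le_succ (n' + k)) le_rfl ((h1 n').2 (by omega))
      rw [h2] at this
      omega
    have h5 : n' ≤ n + 1 := by
      by_contra hlt
      have h6 := (h2 (n + 1)).2 (by omega)
      have := lam.up_left_mem (i1 := n + k + 1) (by omega) (Nat.le_succ n) h6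
      rw [h1] at this
      omega
    have h6 : c ∈ betaSet lam ↔ n = n' := by
      rw [hk, mem_betaSet_negSucc]
      constructor
      · rintro ⟨m, ha, hb⟩
        rw [h2] at ha
        rcases Nat.eq_zero_or_pos m with h0 | h0
        · omega
        · rcases hb with hb | hb
          · omega
          · rw [h3 m h0.ne'] at hb
            omega
      · intro h
        refine ⟨n, by rw [h2]; omega, ?_⟩
        rcases Nat.eq_zero_or_pos n with h0 | h0
        · exact Or.inl h0
        · right
          rw [h3 n h0.ne']
          omega
    simp only [h6, hc, if_true]
    split_ifs <;> omega
  · obtain ⟨k, rfl⟩ := Int.eq_ofNat_of_zero_le hc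
    have h1 : ∀ i, (i, i + k) ∈ lam ↔ i < n := by
      intro i
      rw [hm, show ((i + k : ℕ) : ℤ) - (i : ℤ) = k by push_cast; omega, hn]
      omega
    have h2 : ∀ i, (i, i + k + 1) ∈ lam ↔ i < n' := by
      intro i
      rw [hm, show ((i + k + 1 : ℕ) : ℤ) - (i : ℤ) = k + 1 by push_cast; omega, hn']
      omega
    have h4 : n' ≤ n := by
      by_contra hlt
      have := lam.up_left_mem le_rfl (Nat.le_succ (n + k)) ((h2 n).2 (by omega))
      rw [h1] at this
      omega
    have h5 : n ≤ n' + 1 := by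
      by_contra hlt
      have h6 := (h1 (n' + 1)).2 (by omega)
      have := lam.up_left_mem (j1 := n' + k + 1) (Nat.le_succ n') (by omega) h6
      rw [h2] at this
      omega
    have h6 : (k : ℤ) ∈ betaSet lam ↔ n' < n := by
      rw [mem_betaSet_natCast]
      simp only [h1, h2]
      constructor
      · rintro ⟨i, hi⟩
        omega
      · intro h
        exact ⟨n', by omega⟩
    simp only [h6, hc.not_gt, if_false]
    split_ifs <;> omega

theorem ind_eq_zero_or_one (lam : YoungDiagram) (c : ℤ) : ind lam c = 0 ∨ ind lam c = 1 := by
  unfold ind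
  split_ifs <;> simp

theorem ind_eq_one {lam : YoungDiagram} {c : ℤ} : ind lam c = 1 ↔ c ∈ betaSet lam := by
  unfold ind
  split_ifs with h <;> simp [h]

theorem ind_eq_zero {lam : YoungDiagram} {c : ℤ} : ind lam c = 0 ↔ c ∉ betaSet lam := by
  unfold ind
  split_ifs with h <;> simp [h]

theorem diag_eq_zero (lam : YoungDiagram) {c : ℤ} (hc : (lam.card : ℤ) ≤ |c|) :
    diag lam c = 0 := by
  by_contra h
  have hpos : 0 < diag lam c := lt_of_le_of_ne (diag_nonneg _ _) (Ne.symm h)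
  have key : ∀ a b : ℕ, (a, b) ∈ lam → a + b < lam.card := by
    intro a b hab
    -- The first column down to row `a` and the first row out to column `b` form a hook of `a + b +
    -- 1` nodes.
    have hsub : (Finset.range (a + 1)).image (fun i => (i, 0)) ∪
        (Finset.range b).image (fun j => (0, j + 1)) ⊆ lam.cells := by
      intro q hq
      simp only [Finset.mem_union, Finset.mem_image, Finset.mem_range] at hq
      rw [YoungDiagram.mem_cells]
      rcases hq with ⟨i, hi, rfl⟩ | ⟨j, hj, rfl⟩
      · exact lam.up_left_mem (by omega) (by omega) hab
      · exact lam.up_left_mem (by omega) (by omega) hab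
    have hc := Finset.card_le_card hsub
    rw [Finset.card_union_of_disjoint, Finset.card_image_of_injective,
      Finset.card_image_of_injective, Finset.card_range, Finset.card_range] at hc
    · change _ < lam.cells.card
      omega
    · intro i j hij
      simpa using hij
    · intro i j hij
      simpa using hij
    · rw [Finset.disjoint_left]
      intro q h1 h2
      simp only [Finset.mem_image] at h1 h2
      obtain ⟨i, -, rfl⟩ := h1
      obtain ⟨j, -, h⟩ := h2
      simp at h
  rcases abs_cases c with ⟨h1, h2⟩ | ⟨h1, h2⟩
  · have h3 := (mem_iff_min_lt_diag lam (0, c.toNat)).2 (by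
      simp only [content]
      rw [show ((c.toNat : ℕ) : ℤ) - ((0 : ℕ) : ℤ) = c by omega]
      simpa using hpos)
    have := key _ _ h3
    omega
  · have h3 := (mem_iff_min_lt_diag lam ((-c).toNat, 0)).2 (by
      simp only [content]
      rw [show ((0 : ℕ) : ℤ) - (((-c).toNat : ℕ) : ℤ) = c by omega]
      simpa using hpos)
    have := key _ _ h3
    omega

theorem mem_betaSet_of_lt (lam : YoungDiagram) {c : ℤ} (hc : c < -(lam.card : ℤ)) :
    c ∈ betaSet lam := by
  have h := diag_sub_diag_succ lam c
  rw [diag_eq_zero lam (by rw [abs_of_neg (by omega)]; omega),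
    diag_eq_zero lam (by rw [abs_of_nonpos (by omega)]; omega), if_pos (by omega)] at h
  rw [← ind_eq_one]
  omega

theorem lt_card_of_mem_betaSet (lam : YoungDiagram) {c : ℤ} (hc : c ∈ betaSet lam) :
    c < lam.card := by
  by_contra hlt
  have h := diag_sub_diag_succ lam c
  rw [diag_eq_zero lam (by rw [abs_of_nonneg (by omega)]; omega),
    diag_eq_zero lam (by rw [abs_of_nonneg (by omega)]; omega), if_neg (by omega),
    ind_eq_one.2 hc] at h
  omega

/-- A diagram is determined by its beta-set. -/
theorem eq_of_ind_eq {lam mu : YoungDiagram} (h : ∀ c, ind lam c = ind mu c) : lam = mu := by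
  apply eq_of_diag_eq
  -- Far to the right both counts vanish; equal increments propagate equality leftwards.
  have key : ∀ n : ℕ, ∀ c : ℤ, c = max lam.card mu.card - (n : ℤ) → diag lam c = diag mu c := by
    intro n
    induction n with
    | zero =>
      intro c hc
      have : (lam.card : ℤ) ≤ |c| := (by omega : (lam.card : ℤ) ≤ c).trans (le_abs_self c)
      rw [diag_eq_zero lam this, diag_eq_zero mu]
      exact (by omega : (mu.card : ℤ) ≤ c).trans (le_abs_self c)
    | succ n ih =>
      intro c hc
      have h1 := diag_sub_diag_succ lam c
      have h2 := diag_sub_diag_succ mu c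
      have h3 := ih (c + 1) (by push_cast at hc; omega)
      have h4 := h c
      linarith
  intro c
  rcases le_total (max lam.card mu.card : ℤ) c with hc | hc
  · rw [diag_eq_zero lam, diag_eq_zero mu]
    · exact (by omega : (mu.card : ℤ) ≤ c).trans (le_abs_self c)
    · exact (by omega : (lam.card : ℤ) ≤ c).trans (le_abs_self c)
  · exact key (max lam.card mu.card - c).toNat c (by omega)

/-! ### Realising diagonal lengths by a diagram, and moving beads -/

/-- A finitely supported function on the diagonals with the right increments is nonnegative. -/
theorem nonneg_of_increments {D : ℤ → ℤ} {N : ℤ} (hN : ∀ c, N ≤ |c| → D c = 0)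
    (hD : ∀ c, D c - D (c + 1) + (if c < 0 then 1 else 0) = 0 ∨
      D c - D (c + 1) + (if c < 0 then 1 else 0) = 1) (c : ℤ) : 0 ≤ D c := by
  rcases le_or_gt 0 c with hc | hc
  · have key : ∀ n : ℕ, ∀ c : ℤ, 0 ≤ c → N ≤ c + n → 0 ≤ D c := by
      intro n
      induction n with
      | zero =>
        intro c hc h
        rw [hN c]
        rw [abs_of_nonneg hc]
        simpa using h
      | succ n ih =>
        intro c hc h
        have h1 := ih (c + 1) (by omega) (by push_cast at h; omega)
        have h2 := hD c
        rw [if_neg (by omega)] at h2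
        omega
    exact key (N - c).toNat c hc (by omega)
  · have key : ∀ n : ℕ, ∀ c : ℤ, c ≤ 0 → N ≤ n - c → 0 ≤ D c := by
      intro n
      induction n with
      | zero =>
        intro c hc h
        rw [hN c]
        rw [abs_of_nonpos hc]
        simpa using h
      | succ n ih =>
        intro c hc h
        have h1 := ih (c - 1) (by omega) (by push_cast at h; omega)
        have h2 := hD (c - 1)
        rw [if_pos (by omega), sub_add_cancel] at h2
        omega
    exact key (N + c).toNat c hc.le (by omega)

/-- A finitely supported function on the diagonals with the right increments counts the nodes on
the diagonals of a Young diagram. -/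
theorem exists_diag_eq {D : ℤ → ℤ} {N : ℤ} (hN : ∀ c, N ≤ |c| → D c = 0)
    (hD : ∀ c, D c - D (c + 1) + (if c < 0 then 1 else 0) = 0 ∨
      D c - D (c + 1) + (if c < 0 then 1 else 0) = 1) :
    ∃ mu : YoungDiagram, ∀ c, diag mu c = D c := by
  have hnn := nonneg_of_increments hN hD
  have hfin : {p : ℕ × ℕ | ((min p.1 p.2 : ℕ) : ℤ) < D (content p)}.Finite := by
    obtain ⟨B, hB⟩ : ∃ B : ℤ, ∀ c, D c ≤ B := by
      have : (D '' (Set.Icc (-N) N)).Finite := (Set.finite_Icc _ _).image _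
      obtain ⟨B, hB⟩ := this.bddAbove
      refine ⟨max B 0, fun c => ?_⟩
      rcases le_or_gt N |c| with h | h
      · rw [hN c h]
        exact le_max_right _ _
      · exact (hB ⟨c, by rw [Set.mem_Icc, ← abs_le]; exact h.le, rfl⟩).trans (le_max_left _ _)
    refine ((Set.finite_Iio (B + N).toNat).prod (Set.finite_Iio (B + N).toNat)).subset ?_
    intro p hp
    simp only [Set.mem_ofPred_eq] at hp
    have h1 := hB (content p)
    have h2 : |content p| < N := by
      by_contra h
      rw [hN _ (not_lt.1 h)] at hp
      omega
    rw [abs_lt] at h2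
    unfold content at hp h1 h2
    simp only [Set.mem_prod, Set.mem_Iio]
    omega
  have hlow : IsLowerSet {p : ℕ × ℕ | ((min p.1 p.2 : ℕ) : ℤ) < D (content p)} := by
    have hright : ∀ i j : ℕ, ((min i (j + 1) : ℕ) : ℤ) < D (content (i, j + 1)) →
        ((min i j : ℕ) : ℤ) < D (content (i, j)) := by
      intro i j h
      have h1 := hD (content (i, j))
      rw [show content (i, j + 1) = content (i, j) + 1 by simp [content]; ring] at h
      unfold content at *
      dsimp only at *
      split_ifs at h1 <;> omega
    have hdown : ∀ i j : ℕ, ((min (i + 1) j : ℕ) : ℤ) < D (content (i + 1, j)) →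
        ((min i j : ℕ) : ℤ) < D (content (i, j)) := by
      intro i j h
      have h1 := hD (content (i + 1, j))
      rw [show content (i + 1, j) + 1 = content (i, j) by simp [content]; ring] at h1
      unfold content at *
      dsimp only at *
      push_cast at *
      split_ifs at h1 <;> omega
    have hrow : ∀ i j d : ℕ, ((min i (j + d) : ℕ) : ℤ) < D (content (i, j + d)) →
        ((min i j : ℕ) : ℤ) < D (content (i, j)) := by
      intro i j d
      induction d with
      | zero => exact id
      | succ d ih => exact fun h => ih (hright i (j + d) h)
    have hcol : ∀ i j d : ℕ, ((min (i + d) j : ℕ) : ℤ) < D (content (i + d, j)) →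
        ((min i j : ℕ) : ℤ) < D (content (i, j)) := by
      intro i j d
      induction d with
      | zero => exact id
      | succ d ih => exact fun h => ih (hdown (i + d) j h)
    rintro ⟨i, j⟩ ⟨i', j'⟩ hle hp
    obtain ⟨h1, h2⟩ := Prod.mk_le_mk.1 hle
    obtain ⟨d, rfl⟩ := Nat.exists_eq_add_of_le h1
    obtain ⟨e, rfl⟩ := Nat.exists_eq_add_of_le h2
    exact hrow _ _ e (hcol _ _ d hp)
  refine ⟨⟨hfin.toFinset, by rwa [Set.Finite.coe_toFinset]⟩, fun c => ?_⟩
  have hcard : (hfin.toFinset.filter fun p => content p = c).card =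
      (Finset.range (D c).toNat).card := by
    refine Finset.card_bij (fun p _ => min p.1 p.2) ?_ ?_ ?_
    · intro p hp
      simp only [Finset.mem_filter, Set.Finite.mem_toFinset, Set.mem_ofPred_eq] at hp
      rw [hp.2] at hp
      rw [Finset.mem_range]
      omega
    · intro p hp q hq hpq
      simp only [Finset.mem_filter] at hp hq
      exact eq_of_content_eq_of_min_eq (hp.2.trans hq.2.symm) hpq
    · intro n hn
      rw [Finset.mem_range] at hn
      have hcon : content (n + (-c).toNat, n + c.toNat) = c := by
        unfold content
        dsimp only
        push_cast
        omega
      refine ⟨(n + (-c).toNat, n + c.toNat), ?_, ?_⟩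
      · simp only [Finset.mem_filter, Set.Finite.mem_toFinset, Set.mem_ofPred_eq, hcon, and_true]
        omega
      · dsimp only
        omega
  unfold diag
  dsimp only
  rw [hcard, Finset.card_range, Int.toNat_of_nonneg (hnn c)]

/-- A bead of the beta-set may be moved to any free position. -/
theorem exists_move {lam : YoungDiagram} {b b' : ℤ} (hb : b ∈ betaSet lam)
    (hb' : b' ∉ betaSet lam) :
    ∃ mu : YoungDiagram,
      (∀ c, diag mu c = diag lam c + (if c ≤ b' then 1 else 0) - (if c ≤ b then 1 else 0)) ∧
      ∀ c, ind mu c = ind lam c + (if c = b' then 1 else 0) - (if c = b then 1 else 0) := by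
  have hne : b ≠ b' := fun h => hb' (h ▸ hb)
  rw [← ind_eq_one] at hb
  rw [← ind_eq_zero] at hb'
  have hstep : ∀ a c : ℤ, (if c ≤ a then (1 : ℤ) else 0) - (if c + 1 ≤ a then 1 else 0) =
      if c = a then 1 else 0 := by
    intro a c
    split_ifs <;> omega
  obtain ⟨mu, hmu⟩ := exists_diag_eq
    (D := fun c => diag lam c + (if c ≤ b' then 1 else 0) - (if c ≤ b then 1 else 0))
    -- Beyond both `|b|` and `|b'|` the two step functions agree and cancel.
    (N := max (lam.card : ℤ) (max (|b| + 1) (|b'| + 1))) (by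
      intro c hc
      have h1 := diag_eq_zero lam ((le_max_left _ _).trans hc)
      have h2 : |b| + 1 ≤ |c| := ((le_max_left _ _).trans (le_max_right _ _)).trans hc
      have h3 : |b'| + 1 ≤ |c| := ((le_max_right _ _).trans (le_max_right _ _)).trans hc
      rw [h1]
      have h4 : c ≤ b ↔ c ≤ b' := by
        rcases abs_cases c with h | h <;> rcases abs_cases b with h' | h' <;>
          rcases abs_cases b' with h'' | h'' <;> omega
      simp only [h4]
      ring) (by
      intro c
      have h1 := diag_sub_diag_succ lam c
      have h2 := hstep b c
      have h3 := hstep b' c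
      have h4 := ind_eq_zero_or_one lam c
      have h5 : (diag lam c + (if c ≤ b' then 1 else 0) - (if c ≤ b then 1 else 0)) -
          (diag lam (c + 1) + (if c + 1 ≤ b' then 1 else 0) - (if c + 1 ≤ b then 1 else 0)) +
          (if c < 0 then 1 else 0) =
          ind lam c + (if c = b' then 1 else 0) - (if c = b then 1 else 0) := by linarith
      rw [h5]
      rcases eq_or_ne c b with rfl | hcb
      · rw [if_pos rfl, if_neg hne, hb]
        simp
      · rcases eq_or_ne c b' with rfl | hcb'
        · rw [if_pos rfl, if_neg hcb, hb']
          simp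
        · rw [if_neg hcb, if_neg hcb']
          simpa using h4)
  refine ⟨mu, hmu, fun c => ?_⟩
  have h1 := diag_sub_diag_succ lam c
  have h2 := hstep b c
  have h3 := hstep b' c
  have h4 := diag_sub_diag_succ mu c
  rw [hmu, hmu] at h4
  linarith

/-! ### Rim hooks as bead moves -/

theorem content_of_adj {p q : ℕ × ℕ} (h : nodeGraph.Adj p q) :
    content q = content p + 1 ∨ content p = content q + 1 := by
  unfold nodeGraph at h
  rw [SimpleGraph.hasse_adj, Prod.covBy_iff, Prod.covBy_iff] at h
  simp only [Nat.covBy_iff_add_one_eq] at h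
  unfold content
  omega

theorem adj_right (i j : ℕ) : nodeGraph.Adj (i, j) (i, j + 1) := by
  unfold nodeGraph
  rw [SimpleGraph.hasse_adj, Prod.covBy_iff]
  simp

theorem adj_down (i j : ℕ) : nodeGraph.Adj (i, j) (i + 1, j) := by
  unfold nodeGraph
  rw [SimpleGraph.hasse_adj, Prod.covBy_iff]
  simp

/-- The node of the rim on a given diagonal is the last one. -/
theorem min_eq_of_mem_rim {lam : YoungDiagram} {p : ℕ × ℕ} (hp : p ∈ rim lam) :
    ((min p.1 p.2 : ℕ) : ℤ) = diag lam (content p) - 1 := by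
  obtain ⟨h1, h2⟩ := hp
  rw [mem_iff_min_lt_diag] at h1 h2
  rw [show content (p.1 + 1, p.2 + 1) = content p by simp [content]] at h2
  dsimp only at h2
  omega

theorem content_injOn_rim (lam : YoungDiagram) : Set.InjOn content (rim lam) := by
  intro p hp q hq h
  have h1 := min_eq_of_mem_rim hp
  have h2 := min_eq_of_mem_rim hq
  rw [h] at h1
  exact eq_of_content_eq_of_min_eq h (by omega)

/-- Along a walk the content takes all intermediate values. -/
theorem exists_content_eq_of_walk {H : Set (ℕ × ℕ)} {u v : H} (w : (nodeGraph.induce H).Walk u v)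
    {c : ℤ} (hu : content u ≤ c) (hv : c ≤ content v) : ∃ z : H, content z = c := by
  induction w with
  | nil => exact ⟨_, le_antisymm hu hv⟩
  | @cons a b d h w ih =>
    rcases eq_or_lt_of_le hu with h1 | h1
    · exact ⟨a, h1⟩
    · have := content_of_adj (p := a) (q := b) h
      exact ih (by omega) hv

/-- Removing a rim hook moves a bead `s` places to the left. -/
theorem RemovesRimHook.exists_bead {s : ℕ} {lam mu : YoungDiagram}
    (h : RemovesRimHook s lam mu) :
    ∃ b : ℤ, b ∈ betaSet lam ∧ b - s ∉ betaSet lam ∧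
      ∀ c, ind mu c = ind lam c + (if c = b - s then 1 else 0) - (if c = b then 1 else 0) := by
  obtain ⟨H, hrim, hcard, hconn, hcells⟩ := h
  have hHl : H ⊆ lam.cells := fun p hp => (YoungDiagram.mem_cells _).2 (hrim hp).1
  have hne : H.Nonempty := by
    obtain ⟨p⟩ := hconn.nonempty
    exact ⟨p.1, p.2⟩
  have hinj : Set.InjOn content (H : Set (ℕ × ℕ)) := (content_injOn_rim lam).mono hrim
  obtain ⟨p, hp, hpmin⟩ := H.exists_min_image content hne
  obtain ⟨q, hq, hqmax⟩ := H.exists_max_image content hne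
  -- By connectedness the contents of the hook fill an interval. The rim meets each diagonal at most
  -- once, so this interval has `s` elements.
  have hA : H.image content = Finset.Icc (content p) (content q) := by
    ext c
    simp only [Finset.mem_image, Finset.mem_Icc]
    constructor
    · rintro ⟨z, hz, rfl⟩
      exact ⟨hpmin z hz, hqmax z hz⟩
    · rintro ⟨h1, h2⟩
      obtain ⟨w⟩ := hconn.preconnected ⟨p, hp⟩ ⟨q, hq⟩
      obtain ⟨z, hz⟩ := exists_content_eq_of_walk w (c := c) h1 h2
      exact ⟨z.1, z.2, hz⟩
  have hs : content q + 1 - content p = s := by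
    have h1 := Finset.card_image_of_injOn hinj
    rw [hA, Int.card_Icc, hcard] at h1
    have := hpmin q hq
    omega
  have hdiag : ∀ c, diag mu c = diag lam c - if c ∈ Finset.Icc (content p) (content q) then 1 else 0 := by
    intro c
    have h1 : (H.filter fun z => content z = c).card =
        if c ∈ Finset.Icc (content p) (content q) then 1 else 0 := by
      rw [← hA]
      split_ifs with hc
      · obtain ⟨z, hz, rfl⟩ := Finset.mem_image.1 hc
        rw [Finset.card_eq_one]
        refine ⟨z, ?_⟩
        ext y
        simp only [Finset.mem_filter, Finset.mem_singleton]
        exact ⟨fun hy => hinj hy.1 hz hy.2, fun hy => by rw [hy]; exact ⟨hz, rfl⟩⟩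
      · rw [Finset.card_eq_zero, Finset.filter_eq_empty_iff]
        intro z hz hzc
        exact hc (Finset.mem_image.2 ⟨z, hz, hzc⟩)
    have h2 : mu.cells.filter (fun z => content z = c) =
        lam.cells.filter (fun z => content z = c) \ H.filter (fun z => content z = c) := by
      rw [hcells]
      ext z
      simp only [Finset.mem_filter, Finset.mem_sdiff]
      tauto
    have h3 := Finset.card_sdiff_add_card_eq_card
      (Finset.filter_subset_filter (fun z => content z = c) hHl)
    unfold diag
    rw [h2, ← h3, h1]
    push_cast
    ring
  have hind : ∀ c, ind mu c = ind lam c + (if c = content q - s then 1 else 0) -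
      (if c = content q then 1 else 0) := by
    intro c
    have h1 := diag_sub_diag_succ lam c
    have h2 := diag_sub_diag_succ mu c
    rw [hdiag, hdiag] at h2
    have h3 := hpmin q hq
    have h4 : (if c ∈ Finset.Icc (content p) (content q) then (1 : ℤ) else 0) -
        (if c + 1 ∈ Finset.Icc (content p) (content q) then 1 else 0) =
        (if c = content q then 1 else 0) - (if c = content q - s then 1 else 0) := by
      simp only [Finset.mem_Icc]
      split_ifs <;> omega
    linarith
  have hpq := hpmin q hq
  refine ⟨content q, ?_, ?_, hind⟩
  · have h1 := hind (content q)
    rw [if_pos rfl, if_neg (by omega)] at h1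
    rw [← ind_eq_one]
    rcases ind_eq_zero_or_one lam (content q) with h | h <;>
      rcases ind_eq_zero_or_one mu (content q) with h' | h' <;> omega
  · have h1 := hind (content q - s)
    rw [if_pos rfl, if_neg (by omega)] at h1
    rw [← ind_eq_zero]
    rcases ind_eq_zero_or_one lam (content q - s) with h | h <;>
      rcases ind_eq_zero_or_one mu (content q - s) with h' | h' <;> omega

/-- If position `b - s` is free for a bead `b`, then a rim `s`-hook may be removed. -/
theorem exists_removesRimHook {s : ℕ} (hs : 0 < s) {lam : YoungDiagram} {b : ℤ}
    (hb : b ∈ betaSet lam) (hb' : b - s ∉ betaSet lam) : ∃ mu, RemovesRimHook s lam mu := by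
  obtain ⟨mu, hdiag, -⟩ := exists_move hb hb'
  have hmem : ∀ p, p ∈ lam.cells \ mu.cells ↔ (b - s < content p ∧ content p ≤ b) ∧
      ((min p.1 p.2 : ℕ) : ℤ) = diag lam (content p) - 1 := by
    intro p
    rw [Finset.mem_sdiff, YoungDiagram.mem_cells, YoungDiagram.mem_cells, mem_iff_min_lt_diag,
      mem_iff_min_lt_diag, hdiag]
    split_ifs <;> omega
  have hpos : ∀ c, b - s < c → c ≤ b → 1 ≤ diag lam c := by
    intro c h1 h2
    have h3 := diag_nonneg mu c
    rw [hdiag, if_neg (by omega), if_pos h2] at h3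
    omega
  -- The last node of `lam` on the diagonal `c`.
  let cell : ℤ → ℕ × ℕ := fun c =>
    ((diag lam c - 1).toNat + (-c).toNat, (diag lam c - 1).toNat + c.toNat)
  have hcon : ∀ c, content (cell c) = c := by
    intro c
    simp only [content, cell]
    push_cast
    omega
  have hcell : ∀ c, b - s < c → c ≤ b → cell c ∈ lam.cells \ mu.cells := by
    intro c h1 h2
    rw [hmem, hcon]
    refine ⟨⟨h1, h2⟩, ?_⟩
    have := hpos c h1 h2
    simp only [cell]
    omega
  have huniq : ∀ p ∈ lam.cells \ mu.cells, p = cell (content p) := by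
    intro p hp
    have h1 := (hmem p).1 hp
    have h2 := (hmem _).1 (hcell _ h1.1.1 h1.1.2)
    rw [hcon] at h2
    exact eq_of_content_eq_of_min_eq (hcon _).symm (by omega)
  have hadj : ∀ c, b - s < c → c + 1 ≤ b → nodeGraph.Adj (cell c) (cell (c + 1)) := by
    intro c h1 h2
    have h3 := diag_sub_diag_succ lam c
    have h4 := ind_eq_zero_or_one lam c
    have h5 := hpos c h1 (by omega)
    have h6 := hpos (c + 1) (by omega) h2
    -- The rim node of next larger content lies either directly to the right or directly above.
    by_cases h7 : (cell (c + 1)).1 = (cell c).1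
    · have : cell (c + 1) = ((cell c).1, (cell c).2 + 1) := by
        refine Prod.ext h7 ?_
        have e1 := hcon c
        have e2 := hcon (c + 1)
        unfold content at e1 e2
        omega
      rw [this]
      exact adj_right _ _
    · have h8 : (cell c).1 = (cell (c + 1)).1 + 1 := by
        simp only [cell] at h7 ⊢
        split_ifs at h3 <;> omega
      have : cell c = ((cell (c + 1)).1 + 1, (cell (c + 1)).2) := by
        refine Prod.ext h8 ?_
        have e1 := hcon c
        have e2 := hcon (c + 1)
        unfold content at e1 e2
        dsimp only
        omega
      rw [this]
      exact (adj_down _ _).symm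
  refine ⟨mu, lam.cells \ mu.cells, ?_, ?_, ?_, ?_⟩
  · intro p hp
    have h1 := (hmem p).1 hp
    refine ⟨(YoungDiagram.mem_cells _).1 (Finset.mem_sdiff.1 hp).1, ?_⟩
    rw [mem_iff_min_lt_diag,
      show content (p.1 + 1, p.2 + 1) = content p by simp [content]]
    dsimp only
    omega
  · have himg : (lam.cells \ mu.cells).image content = Finset.Ioc (b - s) b := by
      ext c
      simp only [Finset.mem_image, Finset.mem_Ioc]
      constructor
      · rintro ⟨p, hp, rfl⟩
        exact ((hmem p).1 hp).1
      · rintro ⟨h1, h2⟩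
        exact ⟨cell c, hcell c h1 h2, hcon c⟩
    rw [← Finset.card_image_of_injOn (f := content), himg, Int.card_Ioc]
    · omega
    · intro p hp q hq h
      rw [huniq p hp, huniq q hq, h]
  · have hreach : ∀ n : ℕ, ∀ (h1 : b - s < b - n),
        (nodeGraph.induce ((lam.cells \ mu.cells : Finset (ℕ × ℕ)) : Set (ℕ × ℕ))).Reachable
          ⟨cell (b - n), hcell _ h1 (by omega)⟩ ⟨cell b, hcell b (by omega) le_rfl⟩ := by
      intro n
      induction n with
      | zero =>
        intro h1
        have : cell (b - (0 : ℕ)) = cell b := by simp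
        simp only [this]
        exact SimpleGraph.Reachable.refl _
      | succ n ih =>
        intro h1
        refine SimpleGraph.Reachable.trans (SimpleGraph.Adj.reachable ?_)
          (ih (by push_cast at h1; omega))
        rw [SimpleGraph.comap_adj]
        have := hadj (b - (n + 1 : ℕ)) h1 (by push_cast; omega)
        rw [show b - ((n + 1 : ℕ) : ℤ) + 1 = b - n by push_cast; ring] at this
        exact this
    have hall : ∀ z : ((lam.cells \ mu.cells : Finset (ℕ × ℕ)) : Set (ℕ × ℕ)),
        (nodeGraph.induce ((lam.cells \ mu.cells : Finset (ℕ × ℕ)) : Set (ℕ × ℕ))).Reachable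
          z ⟨cell b, hcell b (by omega) le_rfl⟩ := by
      rintro ⟨p, hp⟩
      have h1 := ((hmem p).1 hp).1
      have h2 := hreach (b - content p).toNat (by omega)
      have h3 : cell (b - ((b - content p).toNat : ℤ)) = p := by
        rw [Int.toNat_of_nonneg (by omega), sub_sub_cancel]
        exact (huniq p hp).symm
      simpa only [h3] using h2
    rw [SimpleGraph.connected_iff]
    exact ⟨fun z z' => (hall z).trans (hall z').symm, ⟨⟨cell b, hcell b (by omega) le_rfl⟩⟩⟩
  · rw [Finset.sdiff_sdiff_eq_self]
    intro p hp
    rw [YoungDiagram.mem_cells, mem_iff_min_lt_diag] at hp ⊢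
    rw [hdiag] at hp
    split_ifs at hp <;> omega

theorem IsCore.sub_mem {s : ℕ} (hs : 0 < s) {lam : YoungDiagram} (h : IsCore s lam) {b : ℤ}
    (hb : b ∈ betaSet lam) : b - s ∈ betaSet lam := by
  by_contra hb'
  obtain ⟨mu, hmu⟩ := exists_removesRimHook hs hb hb'
  exact h mu hmu

theorem RemovesRimHook.card_eq {s : ℕ} {lam mu : YoungDiagram} (h : RemovesRimHook s lam mu) :
    lam.card = mu.card + s := by
  obtain ⟨H, hrim, hcard, -, hcells⟩ := h
  have hHl : H ⊆ lam.cells := fun p hp => (YoungDiagram.mem_cells _).2 (hrim hp).1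
  have := Finset.card_sdiff_add_card_eq_card hHl
  rw [← hcells, hcard] at this
  exact this.symm

theorem RemovesRimHooks.card_eq {s w : ℕ} {lam mu : YoungDiagram}
    (h : RemovesRimHooks s w lam mu) : lam.card = mu.card + s * w := by
  induction h with
  | refl => simp
  | step h _ ih =>
    rw [h.card_eq, ih]
    ring

/-- Every partition has an `s`-core. -/
theorem exists_hasCore {s : ℕ} (hs : 0 < s) (lam : YoungDiagram) : ∃ sig, HasCore s lam sig := by
  induction hn : lam.card using Nat.strong_induction_on generalizing lam with
  | _ n ih =>
    by_cases hc : IsCore s lam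
    · exact ⟨lam, hc, 0, .refl _⟩
    · unfold IsCore at hc
      push Not at hc
      obtain ⟨mu, hmu⟩ := hc
      obtain ⟨sig, hsig, w, hw⟩ := ih mu.card (by rw [← hn, hmu.card_eq]; omega) mu rfl
      exact ⟨sig, hsig, w + 1, .step hmu hw⟩

/-! ### Bead statistics and charges -/

/-- The sum of `f` over the beta-set, relative to the beta-set of the empty partition, written as
a sum over the nodes. -/
def wsum (f : ℤ → ℤ) (lam : YoungDiagram) : ℤ :=
  ∑ p ∈ lam.cells, (f (content p) - f (content p - 1))

theorem wsum_id (lam : YoungDiagram) : wsum id lam = lam.card := by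
  simp [wsum, YoungDiagram.card]

theorem wsum_sum {ι : Type*} (S : Finset ι) (f : ι → ℤ → ℤ) (lam : YoungDiagram) :
    wsum (fun b => ∑ i ∈ S, f i b) lam = ∑ i ∈ S, wsum (f i) lam := by
  unfold wsum
  rw [Finset.sum_comm]
  simp only [Finset.sum_sub_distrib]

theorem finite_support_diag (lam : YoungDiagram) (f : ℤ → ℤ) :
    (Function.support fun c => (diag lam c - diag lam (c + 1)) * f c).Finite := by
  refine (Set.finite_Icc (-(lam.card : ℤ) - 1) lam.card).subset ?_
  intro c hc
  by_contra h
  apply hc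
  rw [Set.mem_Icc] at h
  dsimp only
  rw [diag_eq_zero lam, diag_eq_zero lam]
  · simp
  · rcases abs_cases (c + 1) with h' | h' <;> omega
  · rcases abs_cases c with h' | h' <;> omega

/-- Summation by parts along the diagonals: it turns the sum over nodes into a sum over beads, while
finiteness of the diagram keeps everything finitely supported. -/
theorem wsum_eq_finsum (f : ℤ → ℤ) (lam : YoungDiagram) :
    wsum f lam = ∑ᶠ c, (diag lam c - diag lam (c + 1)) * f c := by
  have hsupp : ∀ p : ℕ × ℕ, (Function.support fun c : ℤ =>
      ((if content p = c then (1 : ℤ) else 0) - (if content p = c + 1 then 1 else 0)) * f c) ⊆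
      (({content p, content p - 1} : Finset ℤ) : Set ℤ) := by
    intro p c hc
    by_contra h
    simp only [Finset.coe_insert, Finset.coe_singleton, Set.mem_insert_iff,
      Set.mem_singleton_iff, not_or] at h
    apply hc
    dsimp only
    rw [if_neg (by omega), if_neg (by omega)]
    simp
  have h1 : ∀ c, (diag lam c - diag lam (c + 1)) * f c = ∑ p ∈ lam.cells,
      ((if content p = c then (1 : ℤ) else 0) - (if content p = c + 1 then 1 else 0)) * f c := by
    intro c
    unfold diag
    rw [← Finset.sum_mul, Finset.sum_sub_distrib, Finset.sum_boole, Finset.sum_boole]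
  simp only [h1]
  rw [finsum_sum_comm]
  · unfold wsum
    refine Finset.sum_congr rfl fun p _ => ?_
    rw [finsum_eq_sum_of_support_subset _ (hsupp p), Finset.sum_pair (by omega), if_pos rfl,
      if_neg (by omega), if_neg (by omega), if_pos (by omega)]
    ring
  · intro p _
    exact (Finset.finite_toSet _).subset (hsupp p)

theorem wsum_sub_wsum (f : ℤ → ℤ) (lam mu : YoungDiagram) :
    wsum f lam - wsum f mu = ∑ᶠ c, (ind lam c - ind mu c) * f c := by
  rw [wsum_eq_finsum, wsum_eq_finsum, ← finsum_sub_distrib (finite_support_diag lam f)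
    (finite_support_diag mu f)]
  refine finsum_congr fun c => ?_
  rw [diag_sub_diag_succ, diag_sub_diag_succ]
  ring

/-- The effect of moving one bead. -/
theorem wsum_of_move (f : ℤ → ℤ) {lam mu : YoungDiagram} {b b' : ℤ}
    (h : ∀ c, ind mu c = ind lam c + (if c = b' then 1 else 0) - (if c = b then 1 else 0)) :
    wsum f mu = wsum f lam + f b' - f b := by
  have h1 := wsum_sub_wsum f mu lam
  have hsupp : (Function.support fun c => (ind mu c - ind lam c) * f c) ⊆
      (({b', b} : Finset ℤ) : Set ℤ) := by
    intro c hc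
    by_contra hn
    simp only [Finset.coe_insert, Finset.coe_singleton, Set.mem_insert_iff,
      Set.mem_singleton_iff, not_or] at hn
    apply hc
    dsimp only
    rw [h, if_neg hn.1, if_neg hn.2]
    ring
  rw [finsum_eq_sum_of_support_subset _ hsupp] at h1
  rcases eq_or_ne b' b with rfl | hne
  · simp [h] at h1
    linarith
  · rw [Finset.sum_pair hne, h, h, if_pos rfl, if_pos rfl, if_neg hne, if_neg hne.symm] at h1
    linarith

/-- The number of beads in a residue class modulo `s`, relative to the empty partition. -/
def charge (s : ℕ) (lam : YoungDiagram) (i : ZMod s) : ℤ :=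
  wsum (fun b => if (b : ZMod s) = i then 1 else 0) lam

theorem charge_of_move (s : ℕ) {lam mu : YoungDiagram} {b b' : ℤ}
    (h : ∀ c, ind mu c = ind lam c + (if c = b' then 1 else 0) - (if c = b then 1 else 0))
    (i : ZMod s) :
    charge s mu i = charge s lam i + (if (b' : ZMod s) = i then 1 else 0) -
      (if (b : ZMod s) = i then 1 else 0) :=
  wsum_of_move _ h

theorem sum_charge (s : ℕ) [NeZero s] (lam : YoungDiagram) : ∑ i : ZMod s, charge s lam i = 0 := by
  unfold charge
  rw [← wsum_sum]
  simp [wsum]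

/-- A move by `s` places keeps the residue of the bead. -/
theorem RemovesRimHooks.charge_eq {s w : ℕ} {lam mu : YoungDiagram}
    (h : RemovesRimHooks s w lam mu) (i : ZMod s) : charge s lam i = charge s mu i := by
  induction h with
  | refl => rfl
  | step h _ ih =>
    obtain ⟨b, -, -, hb⟩ := h.exists_bead
    rw [← ih, charge_of_move s hb]
    simp

/-! ### Cores are determined by their charges -/

section Max

variable {s : ℕ} {lam : YoungDiagram}

theorem bddAbove_residue (lam : YoungDiagram) (i : ZMod s) :
    BddAbove {b : ℤ | b ∈ betaSet lam ∧ (b : ZMod s) = i} :=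
  ⟨lam.card, fun _ hb => (lt_card_of_mem_betaSet lam hb.1).le⟩

theorem nonempty_residue (hs : 0 < s) (lam : YoungDiagram) (i : ZMod s) :
    {b : ℤ | b ∈ betaSet lam ∧ (b : ZMod s) = i}.Nonempty := by
  obtain ⟨z, rfl⟩ := ZMod.intCast_surjective i
  -- Far enough down the class to be below `-lam.card`, where every position holds a bead.
  refine ⟨z - s * (|z| + lam.card + 1), mem_betaSet_of_lt lam ?_, by simp⟩
  have h1 : |z| + lam.card + 1 ≤ s * (|z| + lam.card + 1) :=
    le_mul_of_one_le_left (by positivity) (by omega)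
  have h2 := le_abs_self z
  linarith

theorem maxBeta_mem (hs : 0 < s) (lam : YoungDiagram) (i : ZMod s) :
    maxBeta s lam i ∈ betaSet lam ∧ ((maxBeta s lam i : ℤ) : ZMod s) = i :=
  Int.csSup_mem (nonempty_residue hs lam i) (bddAbove_residue lam i)

theorem le_maxBeta {b : ℤ} {i : ZMod s} (hb : b ∈ betaSet lam) (hi : (b : ZMod s) = i) :
    b ≤ maxBeta s lam i :=
  le_csSup (bddAbove_residue lam i) ⟨hb, hi⟩

/-- The beads of a core are pushed down as far as possible: each class contains its maximum and, by
closure under subtracting `s`, everything below it. -/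
theorem IsCore.mem_betaSet_iff (hs : 0 < s) (h : IsCore s lam) (b : ℤ) :
    b ∈ betaSet lam ↔ b ≤ maxBeta s lam (b : ZMod s) := by
  refine ⟨fun hb => le_maxBeta hb rfl, fun hb => ?_⟩
  obtain ⟨h1, h2⟩ := maxBeta_mem hs lam (b : ZMod s)
  obtain ⟨k, hk⟩ := (ZMod.intCast_eq_intCast_iff_dvd_sub _ _ _).1 h2.symm
  have hk0 : 0 ≤ k := by
    have : 0 ≤ (s : ℤ) * k := by rw [← hk]; omega
    exact nonneg_of_mul_nonneg_right this (by omega)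
  obtain ⟨n, rfl⟩ := Int.eq_ofNat_of_zero_le hk0
  have key : ∀ n : ℕ, maxBeta s lam (b : ZMod s) - s * n ∈ betaSet lam := by
    intro n
    induction n with
    | zero => simpa using h1
    | succ n ih =>
      have := h.sub_mem hs ih
      rwa [show maxBeta s lam (b : ZMod s) - s * n - s =
        maxBeta s lam (b : ZMod s) - s * ((n + 1 : ℕ) : ℤ) by push_cast; ring] at this
  have := key n
  rwa [← hk, sub_sub_cancel] at this

end Max

theorem charge_sub_charge_of_maxBeta {s : ℕ} (hs : 0 < s) {sig tau : YoungDiagram}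
    (hsig : IsCore s sig) (htau : IsCore s tau) (i : ZMod s) (d : ℕ)
    (hd : maxBeta s sig i = maxBeta s tau i + s * d) :
    charge s sig i - charge s tau i = d := by
  have hmt := (maxBeta_mem hs tau i).2
  unfold charge
  rw [wsum_sub_wsum]
  -- Within the class `i` the two beta-sets differ exactly in the `d` positions following the
  -- maximum for `tau`.
  have hval : ∀ c : ℤ, (ind sig c - ind tau c) * (if (c : ZMod s) = i then 1 else 0) =
      if c ∈ (Finset.range d).image (fun k : ℕ => maxBeta s tau i + s * ((k : ℤ) + 1))
        then 1 else 0 := by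
    intro c
    by_cases hc : (c : ZMod s) = i
    · rw [if_pos hc, mul_one]
      have h1 := hsig.mem_betaSet_iff hs c
      have h2 := htau.mem_betaSet_iff hs c
      rw [hc] at h1 h2
      obtain ⟨k, hk⟩ := (ZMod.intCast_eq_intCast_iff_dvd_sub _ _ _).1 (hmt.trans hc.symm)
      have hs' : (0 : ℤ) < s := by omega
      have h3 : c ∈ betaSet tau ↔ k ≤ 0 := by
        rw [h2, ← sub_nonpos, hk]
        exact ⟨fun h => nonpos_of_mul_nonpos_right h hs',
          fun h => mul_nonpos_of_nonneg_of_nonpos hs'.le h⟩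
      have h4 : c ∈ betaSet sig ↔ k ≤ d := by
        rw [h1, hd, ← mul_le_mul_iff_right₀ (b := k) hs', ← hk]
        constructor <;> intro h <;> linarith
      have h5 : c ∈ (Finset.range d).image (fun k : ℕ => maxBeta s tau i + s * ((k : ℤ) + 1)) ↔
          1 ≤ k ∧ k ≤ d := by
        simp only [Finset.mem_image, Finset.mem_range]
        constructor
        · rintro ⟨n, hn, hnc⟩
          have : (s : ℤ) * k = s * (n + 1) := by rw [← hk, ← hnc]; ring
          have := mul_left_cancel₀ hs'.ne' this
          omega
        · rintro ⟨ha, hb⟩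
          refine ⟨(k - 1).toNat, by omega, ?_⟩
          rw [Int.toNat_of_nonneg (by omega), sub_add_cancel, ← hk]
          ring
      unfold ind
      simp only [h3, h4, h5]
      split_ifs <;> omega
    · rw [if_neg hc, mul_zero, if_neg]
      intro hmem
      simp only [Finset.mem_image] at hmem
      obtain ⟨k, -, rfl⟩ := hmem
      exact hc (by push_cast; rw [hmt]; simp)
  simp only [hval]
  rw [finsum_eq_sum_of_support_subset (s := (Finset.range d).image
    (fun k : ℕ => maxBeta s tau i + s * ((k : ℤ) + 1)))]
  · rw [Finset.sum_ite_mem, Finset.inter_self, Finset.sum_const, Finset.card_image_of_injective]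
    · simp
    · intro a b hab
      simpa [hs.ne'] using hab
  · intro c hc
    by_contra h
    exact hc (if_neg h)

/-- For `s`-cores the charges differ by `δ`. -/
theorem charge_sub_charge_eq_delta {s : ℕ} (hs : 0 < s) {sig tau : YoungDiagram}
    (hsig : IsCore s sig) (htau : IsCore s tau) (i : ZMod s) :
    charge s sig i - charge s tau i = delta s sig tau i := by
  obtain ⟨k, hk⟩ := (ZMod.intCast_eq_intCast_iff_dvd_sub _ _ _).1
    ((maxBeta_mem hs tau i).2.trans (maxBeta_mem hs sig i).2.symm)
  have hs' : (s : ℤ) ≠ 0 := by omega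
  unfold delta
  rw [hk, Int.mul_ediv_cancel_left _ hs']
  rcases le_total 0 k with h | h
  · obtain ⟨d, rfl⟩ := Int.eq_ofNat_of_zero_le h
    exact charge_sub_charge_of_maxBeta hs hsig htau i d (by linarith)
  · obtain ⟨d, hd⟩ := Int.eq_ofNat_of_zero_le (neg_nonneg.2 h)
    have := charge_sub_charge_of_maxBeta hs htau hsig i d (by rw [← hd]; linarith)
    rw [← hd] at this
    linarith

/-- An `s`-core is determined by its charges. -/
theorem IsCore.eq_of_charge_eq {s : ℕ} (hs : 0 < s) {sig tau : YoungDiagram}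
    (hsig : IsCore s sig) (htau : IsCore s tau) (h : ∀ i, charge s sig i = charge s tau i) :
    sig = tau := by
  have hmax : ∀ i, maxBeta s sig i = maxBeta s tau i := by
    intro i
    obtain ⟨k, hk⟩ := (ZMod.intCast_eq_intCast_iff_dvd_sub _ _ _).1
      ((maxBeta_mem hs tau i).2.trans (maxBeta_mem hs sig i).2.symm)
    have h1 := charge_sub_charge_eq_delta hs hsig htau i
    unfold delta at h1
    rw [h, sub_self, hk, Int.mul_ediv_cancel_left _ (by omega)] at h1
    rw [← h1, mul_zero] at hk
    linarith
  apply eq_of_ind_eq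
  intro c
  unfold ind
  simp only [hsig.mem_betaSet_iff hs, htau.mem_betaSet_iff hs, hmax]

/-- Hook removal keeps charges; conversely any core that is reached has the charges of `sig`, hence
equals `sig`. -/
theorem hasCore_iff {s : ℕ} (hs : 0 < s) {lam sig : YoungDiagram} :
    HasCore s lam sig ↔ IsCore s sig ∧ ∀ i, charge s lam i = charge s sig i := by
  constructor
  · rintro ⟨h, w, hw⟩
    exact ⟨h, hw.charge_eq⟩
  · rintro ⟨h, hc⟩
    obtain ⟨nu, hnu, w, hw⟩ := exists_hasCore hs lam
    have : nu = sig := hnu.eq_of_charge_eq hs h fun i => by rw [← hw.charge_eq, hc]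
    subst this
    exact ⟨hnu, w, hw⟩

/-- The core reached is unique and every hook has `s` nodes, so the weight can be read off from
sizes. -/
theorem hasWeight_iff {s : ℕ} (hs : 0 < s) {lam sig : YoungDiagram} (h : HasCore s lam sig)
    (w : ℕ) : HasWeight s lam w ↔ lam.card = sig.card + s * w := by
  obtain ⟨hcore, w', hw'⟩ := h
  constructor
  · rintro ⟨nu, hnu, hw⟩
    have : nu = sig := hnu.eq_of_charge_eq hs hcore fun i => by
      rw [← hw.charge_eq, hw'.charge_eq]
    rw [← this]
    exact hw.card_eq
  · intro hc
    have h1 := hw'.card_eq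
    rw [hc, Nat.add_left_cancel_iff] at h1
    rw [Nat.eq_of_mul_eq_mul_left hs h1]
    exact ⟨sig, hcore, hw'⟩

/-! ### The moment and the lower bound for the weight -/

/-- The residue class of `x + n t` modulo `s`. -/
def cls (s t : ℕ) (x : ℤ) (n : ℕ) : ZMod s := ((x + (n : ℤ) * (t : ℤ) : ℤ) : ZMod s)

theorem cls_add (s t : ℕ) (x : ℤ) (m n : ℕ) :
    cls s t x (m + n) = cls s t x m + ((n * t : ℤ) : ZMod s) := by
  unfold cls
  push_cast
  ring

theorem cls_inj {s t : ℕ} (hst : Nat.Coprime s t) {x : ℤ} {m n : ℕ} (hm : m < s) (hn : n < s)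
    (h : cls s t x m = cls s t x n) : m = n := by
  unfold cls at h
  rw [ZMod.intCast_eq_intCast_iff_dvd_sub] at h
  have h1 : (s : ℤ) ∣ ((n : ℤ) - m) * t := by
    rwa [show x + (n : ℤ) * t - (x + m * t) = ((n : ℤ) - m) * t by ring] at h
  have h2 : (s : ℤ) ∣ (n : ℤ) - m :=
    (Int.isCoprime_iff_gcd_eq_one.2 (by simpa using hst)).dvd_of_dvd_mul_right h1
  have h3 := Int.eq_zero_of_abs_lt_dvd h2 (by rw [abs_lt]; omega)
  omega

theorem cls_succ_inj {s t : ℕ} (hst : Nat.Coprime s t) {x : ℤ} {m n : ℕ} (hm : m < s)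
    (hn : n < s) (h : cls s t x (m + 1) = cls s t x (n + 1)) : m = n := by
  rw [cls_add, cls_add] at h
  exact cls_inj hst hm hn (add_right_cancel h)

theorem image_cls {s t : ℕ} [NeZero s] (hst : Nat.Coprime s t) (x : ℤ) :
    (Finset.range s).image (cls s t x) = Finset.univ := by
  apply Finset.eq_univ_of_card
  rw [Finset.card_image_of_injOn, Finset.card_range, ZMod.card]
  intro m hm n hn h
  exact cls_inj hst (by simpa using hm) (by simpa using hn) h

theorem sum_cls {s t : ℕ} [NeZero s] (hst : Nat.Coprime s t) (x : ℤ) (g : ZMod s → ℤ) :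
    ∑ n ∈ Finset.range s, g (cls s t x n) = ∑ i, g i := by
  rw [← image_cls hst x, Finset.sum_image]
  intro m hm n hn h
  exact cls_inj hst (by simpa using hm) (by simpa using hn) h

theorem cls_succ (s t : ℕ) (x : ℤ) (n : ℕ) : cls s t x (n + 1) = cls s t (x + t) n := by
  unfold cls
  push_cast
  ring

theorem sum_cls_succ {s t : ℕ} [NeZero s] (hst : Nat.Coprime s t) (x : ℤ) (g : ZMod s → ℤ) :
    ∑ n ∈ Finset.range s, g (cls s t x (n + 1)) = ∑ i, g i := by
  simp only [cls_succ]
  exact sum_cls hst _ g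

theorem exists_cls_succ_eq {s t : ℕ} [NeZero s] (hst : Nat.Coprime s t) (x : ℤ) (i : ZMod s) :
    ∃ n < s, cls s t x (n + 1) = i := by
  have h := Finset.mem_univ i
  rw [← image_cls hst (x + t), Finset.mem_image] at h
  obtain ⟨n, hn, h⟩ := h
  exact ⟨n, Finset.mem_range.1 hn, by rw [cls_succ, h]⟩

/-- The statistic `∑ j c_{x + j t}`, where `c_i` are the charges modulo `s`. -/
def moment (s t : ℕ) (x : ℤ) (lam : YoungDiagram) : ℤ :=
  ∑ n ∈ Finset.range s, ((n : ℤ) + 1) * charge s lam (cls s t x (n + 1))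

/-- Adding a rim `t`-hook raises the moment by at most one. -/
theorem RemovesRimHook.moment_le {s t : ℕ} [NeZero s] (hst : Nat.Coprime s t) (x : ℤ)
    {lam mu : YoungDiagram} (h : RemovesRimHook t lam mu) :
    moment s t x lam ≤ moment s t x mu + 1 := by
  obtain ⟨b, -, -, hb⟩ := h.exists_bead
  -- Marks the class of the new position `b - t`; the old position `b` lies one index later.
  let g : ℕ → ℤ := fun n => if ((b - t : ℤ) : ZMod s) = cls s t x n then 1 else 0
  have hshift : ∀ n, (if (b : ZMod s) = cls s t x (n + 1) then (1 : ℤ) else 0) = g n := by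
    intro n
    simp only [g]
    congr 1
    rw [cls_add, eq_iff_iff]
    push_cast
    rw [sub_eq_iff_eq_add, one_mul]
  have h1 : moment s t x mu = moment s t x lam +
      ∑ n ∈ Finset.range s, ((n : ℤ) + 1) * g (n + 1) -
      ∑ n ∈ Finset.range s, ((n : ℤ) + 1) * g n := by
    unfold moment
    rw [← Finset.sum_add_distrib, ← Finset.sum_sub_distrib]
    refine Finset.sum_congr rfl fun n _ => ?_
    rw [charge_of_move s hb, hshift]
    simp only [g]
    ring
  have h2 : ∑ n ∈ Finset.range s, g n = 1 := by
    have := sum_cls hst x (fun z => if ((b - t : ℤ) : ZMod s) = z then 1 else 0)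
    simp only [g]
    rw [this]
    simp
  -- Peeling off the last or the first term of the sum of `n * g n` over `n ≤ s` shows that the
  -- moment changes by `s * g s - 1`. The term `s * g s` is the wrap-around at the class of `x`.
  have h3 := Finset.sum_range_succ (fun n : ℕ => (n : ℤ) * g n) s
  have h4 := Finset.sum_range_succ' (fun n : ℕ => (n : ℤ) * g n) s
  have h5 : 0 ≤ (s : ℤ) * g s := by
    simp only [g]
    split_ifs <;> simp
  have h6 : ∑ n ∈ Finset.range s, ((n : ℤ) + 1) * g n =
      ∑ n ∈ Finset.range s, (n : ℤ) * g n + ∑ n ∈ Finset.range s, g n := by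
    rw [← Finset.sum_add_distrib]
    exact Finset.sum_congr rfl fun n _ => by ring
  push_cast at h4
  linarith

theorem RemovesRimHooks.moment_le {s t w : ℕ} [NeZero s] (hst : Nat.Coprime s t) (x : ℤ)
    {lam mu : YoungDiagram} (h : RemovesRimHooks t w lam mu) :
    moment s t x lam ≤ moment s t x mu + w := by
  induction h with
  | refl => simp
  | step h _ ih =>
    have := h.moment_le hst x
    push_cast
    linarith

/-! ### Attaining the bound -/

/-- Take `i` the first nonzero index, positive since partial sums are nonnegative, and `k` the first
negative index after it. Partial sums stay positive in between, so shifting a unit from `i` to `k`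
keeps them all nonnegative. -/
theorem exists_pos_neg_of_partial_sums {e : ℕ → ℤ} {s : ℕ}
    (hnn : ∀ k ≤ s, 0 ≤ ∑ n ∈ Finset.range k, e n) (hs : ∑ n ∈ Finset.range s, e n = 0)
    (hne : ∃ n < s, e n ≠ 0) :
    ∃ i k, i < k ∧ k < s ∧ 0 < e i ∧ e k < 0 ∧
      ∀ m, i < m → m ≤ k → 0 < ∑ n ∈ Finset.range m, e n := by
  classical
  obtain ⟨his, hie⟩ := Nat.find_spec hne
  have hmin : ∀ n < Nat.find hne, e n = 0 := by
    intro n hn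
    have := Nat.find_min hne hn
    by_contra h
    exact this ⟨hn.trans his, h⟩
  generalize Nat.find hne = i at his hie hmin
  have hzero : ∑ n ∈ Finset.range i, e n = 0 :=
    Finset.sum_eq_zero fun n hn => hmin n (Finset.mem_range.1 hn)
  have hi : 0 < e i := by
    have := hnn (i + 1) his
    rw [Finset.sum_range_succ, hzero] at this
    omega
  have hpos : ∀ K, (∀ n, i < n → n < K → 0 ≤ e n) → ∀ m, i < m → m ≤ K →
      0 < ∑ n ∈ Finset.range m, e n := by
    intro K hK m him
    induction m, him using Nat.le_induction with
    | base =>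
      intro _
      rw [Finset.sum_range_succ, hzero]
      omega
    | succ m hm ih =>
      intro h
      rw [Finset.sum_range_succ]
      have h1 := ih (by omega)
      have h2 := hK m (by omega) (by omega)
      omega
  have hex : ∃ k, i < k ∧ k < s ∧ e k < 0 := by
    by_contra hcon
    push Not at hcon
    have := hpos s hcon s his le_rfl
    omega
  obtain ⟨h1, h2, h3⟩ := Nat.find_spec hex
  refine ⟨i, Nat.find hex, h1, h2, hi, h3, hpos _ ?_⟩
  intro n hn1 hn2
  by_contra hneg
  exact Nat.find_min hex hn2 ⟨hn1, hn2.trans h2, not_le.1 hneg⟩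

/-- If the beta-set of `sig` is closed under subtraction of `u`, and compared to `sig` the diagram
`lam` has more beads in the class `i` and fewer in the class `i + u`, then some bead of `lam` in
the class `i` may be moved `u` places to the right. -/
theorem exists_movable_bead {s : ℕ} {lam sig : YoungDiagram} {u : ℤ}
    (hsig : ∀ b ∈ betaSet sig, b - u ∈ betaSet sig) {i : ZMod s}
    (h1 : charge s sig i < charge s lam i)
    (h2 : charge s lam (i + (u : ZMod s)) < charge s sig (i + (u : ZMod s))) :
    ∃ b ∈ betaSet lam, (b : ZMod s) = i ∧ b + u ∉ betaSet lam := by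
  by_contra hcon
  push Not at hcon
  have e1 : charge s sig i - charge s lam i = _ := wsum_sub_wsum _ sig lam
  have e2 : charge s lam (i + (u : ZMod s)) - charge s sig (i + (u : ZMod s)) = _ :=
    wsum_sub_wsum _ lam sig
  -- Shifting by `u` allows the two classes to be compared bead by bead: if no bead is movable,
  -- every term of the combined sum is nonnegative, although the sum is negative.
  rw [← finsum_comp_equiv (Equiv.addRight u)] at e2
  have hfin : ∀ (mu nu : YoungDiagram) (f : ℤ → ℤ),
      (Function.support fun c => (ind mu c - ind nu c) * f c).Finite := by
    intro mu nu f
    refine ((finite_support_diag mu f).union (finite_support_diag nu f)).subset ?_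
    intro c hc
    by_contra h
    simp only [Set.mem_union, Function.mem_support, not_or, not_not] at h
    apply hc
    have h3 := diag_sub_diag_succ mu c
    have h4 := diag_sub_diag_succ nu c
    dsimp only
    rw [show ind mu c - ind nu c = (diag mu c - diag mu (c + 1)) -
      (diag nu c - diag nu (c + 1)) by linarith, sub_mul, h.1, h.2, sub_zero]
  have e3 : 0 ≤ (charge s sig i - charge s lam i) +
      (charge s lam (i + (u : ZMod s)) - charge s sig (i + (u : ZMod s))) := by
    rw [e1, e2, ← finsum_add_distrib]
    · refine finsum_nonneg fun c => ?_
      simp only [Equiv.coe_addRight, Int.cast_add, add_left_inj]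
      by_cases hc : (c : ZMod s) = i
      · have h3 : ind lam c ≤ ind lam (c + u) := by
          unfold ind
          split_ifs with ha hb <;> try simp
          exact hb (hcon c ha hc)
        have h4 : ind sig (c + u) ≤ ind sig c := by
          unfold ind
          split_ifs with ha hb <;> try simp
          exact hb (by simpa using hsig _ ha)
        rw [if_pos hc]
        linarith
      · simp [hc]
    · exact hfin sig lam _
    · exact (hfin lam sig fun c => if (c : ZMod s) = i + (u : ZMod s) then 1 else 0).preimage
        (Equiv.addRight u).injective.injOn
  linarith

/-- Beads may be moved by multiples of `t` until the charges modulo `s` are those of `sig`. -/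
theorem exists_charge_eq {s t : ℕ} [NeZero s] (ht : 0 < t) (hst : Nat.Coprime s t) (x : ℤ)
    {sig : YoungDiagram} (hsig : IsCore t sig) (lam : YoungDiagram)
    (hnn : ∀ k ≤ s, 0 ≤ ∑ n ∈ Finset.range k,
      (charge s lam (cls s t x (n + 1)) - charge s sig (cls s t x (n + 1)))) :
    ∃ mu : YoungDiagram, (∀ i, charge t mu i = charge t lam i) ∧
      (∀ i, charge s mu i = charge s sig i) ∧
      (mu.card : ℤ) - lam.card = t * (moment s t x mu - moment s t x lam) := by
  -- The measure is the sum of all partial sums of the surplus; each move lowers the partial sums of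
  -- lengths `i + 1, …, k` by one.
  induction hA : (∑ k ∈ Finset.range (s + 1), ∑ n ∈ Finset.range k,
      (charge s lam (cls s t x (n + 1)) - charge s sig (cls s t x (n + 1)))).toNat
    using Nat.strong_induction_on generalizing lam with
  | _ N ih =>
    by_cases hall : ∀ n < s, charge s lam (cls s t x (n + 1)) - charge s sig (cls s t x (n + 1)) = 0
    · refine ⟨lam, fun _ => rfl, fun i => ?_, by simp⟩
      obtain ⟨n, hn, rfl⟩ := exists_cls_succ_eq hst x i
      exact sub_eq_zero.1 (hall n hn)
    · push Not at hall
      have htot : ∑ n ∈ Finset.range s,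
          (charge s lam (cls s t x (n + 1)) - charge s sig (cls s t x (n + 1))) = 0 := by
        rw [Finset.sum_sub_distrib, sum_cls_succ hst, sum_cls_succ hst, sum_charge, sum_charge,
          sub_zero]
      obtain ⟨i, k, hik, hks, hi, hk, hpos⟩ := exists_pos_neg_of_partial_sums hnn htot hall
      obtain ⟨d, rfl⟩ := Nat.exists_eq_add_of_le hik.le
      have hcls : cls s t x (i + d + 1) = cls s t x (i + 1) + ((d * t : ℤ) : ZMod s) := by
        rw [show i + d + 1 = i + 1 + d by ring, cls_add]
      have hclosed : ∀ b ∈ betaSet sig, b - (d * t : ℤ) ∈ betaSet sig := by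
        intro b hb
        clear hik hks hk hpos hcls
        induction d with
        | zero => simpa using hb
        | succ d ihd =>
          have := hsig.sub_mem ht ihd
          rwa [show b - (d * t : ℤ) - t = b - ((d + 1 : ℕ) * t : ℤ) by push_cast; ring] at this
      obtain ⟨b, hb, hbi, hbd⟩ := exists_movable_bead (s := s) (lam := lam) hclosed
        (i := cls s t x (i + 1)) (by linarith) (by rw [← hcls]; linarith)
      obtain ⟨mu, -, hmu⟩ := exists_move hb hbd
      have hch := charge_of_move s hmu
      have hbd' : ((b + (d * t : ℤ) : ℤ) : ZMod s) = cls s t x (i + d + 1) := by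
        rw [hcls, ← hbi]
        push_cast
        ring
      rw [hbd', hbi] at hch
      have hch' : ∀ n < s, charge s mu (cls s t x (n + 1)) = charge s lam (cls s t x (n + 1)) +
          (if i + d = n then 1 else 0) - (if i = n then 1 else 0) := by
        intro n hn
        have e1 : cls s t x (i + d + 1) = cls s t x (n + 1) ↔ i + d = n :=
          ⟨cls_succ_inj hst hks hn, fun h => by rw [h]⟩
        have e2 : cls s t x (i + 1) = cls s t x (n + 1) ↔ i = n :=
          ⟨cls_succ_inj hst (by omega) hn, fun h => by rw [h]⟩
        rw [hch]
        simp only [e1, e2]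
      have hpart : ∀ m ≤ s, ∑ n ∈ Finset.range m,
          (charge s mu (cls s t x (n + 1)) - charge s sig (cls s t x (n + 1))) =
          ∑ n ∈ Finset.range m,
          (charge s lam (cls s t x (n + 1)) - charge s sig (cls s t x (n + 1))) +
          (if i + d < m then 1 else 0) - (if i < m then 1 else 0) := by
        intro m hm
        have e1 : ∀ a : ℕ, (if a < m then (1 : ℤ) else 0) =
            ∑ n ∈ Finset.range m, if a = n then 1 else 0 := by
          intro a
          rw [Finset.sum_ite_eq]
          simp only [Finset.mem_range]
        rw [e1, e1, ← Finset.sum_add_distrib, ← Finset.sum_sub_distrib]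
        refine Finset.sum_congr rfl fun n hn => ?_
        rw [hch' n ((Finset.mem_range.1 hn).trans_le hm)]
        ring
      have hnn' : ∀ m ≤ s, 0 ≤ ∑ n ∈ Finset.range m,
          (charge s mu (cls s t x (n + 1)) - charge s sig (cls s t x (n + 1))) := by
        intro m hm
        have e1 := hpart m hm
        have e2 := hnn m hm
        have e3 := hpos m
        split_ifs at e1 <;> omega
      have hmeas : ∑ m ∈ Finset.range (s + 1), ∑ n ∈ Finset.range m,
          (charge s mu (cls s t x (n + 1)) - charge s sig (cls s t x (n + 1))) <
          ∑ m ∈ Finset.range (s + 1), ∑ n ∈ Finset.range m,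
          (charge s lam (cls s t x (n + 1)) - charge s sig (cls s t x (n + 1))) := by
        refine Finset.sum_lt_sum ?_ ⟨i + d, Finset.mem_range.2 (by omega), ?_⟩
        · intro m hm
          rw [hpart m (by rw [Finset.mem_range] at hm; omega)]
          split_ifs <;> omega
        · rw [hpart (i + d) hks.le, if_neg (lt_irrefl _), if_pos hik]
          omega
      have hmnn : 0 ≤ ∑ m ∈ Finset.range (s + 1), ∑ n ∈ Finset.range m,
          (charge s mu (cls s t x (n + 1)) - charge s sig (cls s t x (n + 1))) :=
        Finset.sum_nonneg fun m hm => hnn' m (by rw [Finset.mem_range] at hm; omega)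
      obtain ⟨nu, h1, h2, h3⟩ := ih _ (by omega) mu hnn' rfl
      refine ⟨nu, fun z => ?_, h2, ?_⟩
      · rw [h1, charge_of_move t hmu]
        simp
      · have e1 : (mu.card : ℤ) = lam.card + d * t := by
          have := wsum_of_move id hmu
          rw [wsum_id, wsum_id] at this
          simp only [id] at this
          linarith
        have e2 : moment s t x mu = moment s t x lam + d := by
          -- The bead passes from weight `i + 1` to weight `i + d + 1`, matching a growth of `d * t`
          -- nodes.
          have e3 : ∀ a < s, ∑ n ∈ Finset.range s, ((n : ℤ) + 1) * (if a = n then 1 else 0) =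
              a + 1 := by
            intro a ha
            simp only [mul_ite, mul_one, mul_zero]
            rw [Finset.sum_ite_eq, if_pos (Finset.mem_range.2 ha)]
          have e4 : moment s t x mu = moment s t x lam +
              ∑ n ∈ Finset.range s, ((n : ℤ) + 1) * (if i + d = n then 1 else 0) -
              ∑ n ∈ Finset.range s, ((n : ℤ) + 1) * (if i = n then 1 else 0) := by
            unfold moment
            rw [← Finset.sum_add_distrib, ← Finset.sum_sub_distrib]
            refine Finset.sum_congr rfl fun n hn => ?_
            rw [hch' n (Finset.mem_range.1 hn)]
            ring
          rw [e3 _ hks, e3 _ (by omega)] at e4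
          push_cast at e4
          linarith
        rw [e2] at h3
        linarith

/-! ### Peaks and the minimal size -/

theorem peakWeight_eq_moment {s t : ℕ} (hs : 0 < s) {sig tau : YoungDiagram}
    (hsig : IsCore s sig) (htau : IsCore s tau) (x : ℤ) :
    peakWeight s t sig tau x = moment s t x sig - moment s t x tau := by
  unfold moment peakWeight
  rw [← Finset.sum_sub_distrib]
  have h1 : ∀ n ∈ Finset.range s, ((n : ℤ) + 1) * charge s sig (cls s t x (n + 1)) -
      ((n : ℤ) + 1) * charge s tau (cls s t x (n + 1)) =
      ((1 + n : ℕ) : ℤ) * delta s sig tau (cls s t x (1 + n)) := by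
    intro n _
    rw [← charge_sub_charge_eq_delta hs hsig htau, add_comm 1 n]
    push_cast
    ring
  rw [Finset.sum_congr rfl h1]
  -- The summand `s δ_x` is the term `n = s`, as `x + st` lies in the class of `x`.
  have h2 := Finset.sum_Ico_eq_sum_range
    (fun n : ℕ => (n : ℤ) * delta s sig tau (cls s t x n)) 1 (s + 1)
  rw [Nat.add_sub_cancel] at h2
  rw [← h2, Finset.sum_Ico_succ_top (by omega)]
  have h3 : cls s t x s = (x : ZMod s) := by simp [cls]
  rw [h3]
  rfl

theorem sum_delta {s : ℕ} [NeZero s] {sig tau : YoungDiagram} (hsig : IsCore s sig)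
    (htau : IsCore s tau) : ∑ i, delta s sig tau i = 0 := by
  simp only [← charge_sub_charge_eq_delta (NeZero.pos s) hsig htau]
  rw [Finset.sum_sub_distrib, sum_charge, sum_charge, sub_zero]

/-- A full cycle meets every class once and the `δ_i` sum to zero. Maximality over `l < s` thus
extends to all `l`, so that partial sums may start at the peak and wrap around. -/
theorem deltaSum_add_period {s t : ℕ} [NeZero s] (hst : Nat.Coprime s t) {sig tau : YoungDiagram}
    (hsig : IsCore s sig) (htau : IsCore s tau) (n : ℕ) :
    deltaSum s t sig tau (n + s) = deltaSum s t sig tau n := by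
  unfold deltaSum
  rw [show n + s + 1 = n + 1 + s by ring, Finset.sum_range_add, add_eq_left,
    ← sum_delta hsig htau, ← sum_cls hst ((n + 1) * t : ℤ)]
  refine Finset.sum_congr rfl fun j _ => ?_
  congr 1
  unfold cls
  push_cast
  ring

/-- At a peak the partial sums starting there are nonpositive. -/
theorem IsPeak.sum_delta_nonpos {s t : ℕ} [NeZero s] (hst : Nat.Coprime s t)
    {sig tau : YoungDiagram} (hsig : IsCore s sig) (htau : IsCore s tau) {x : ℤ}
    (hx : IsPeak s t sig tau x) (m : ℕ) :
    ∑ n ∈ Finset.range m, delta s sig tau (cls s t x (n + 1)) ≤ 0 := by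
  obtain ⟨k, -, hmax, hxk⟩ := hx
  have hxk' : (x : ZMod s) = ((k * t : ℕ) : ZMod s) := by
    rw [hxk]
    exact (maxBeta_mem (NeZero.pos s) tau _).2
  have hle : ∀ n, deltaSum s t sig tau n ≤ deltaSum s t sig tau k := by
    intro n
    induction n using Nat.strong_induction_on with
    | _ n ih =>
      rcases lt_or_ge n s with h | h
      · exact hmax n h
      · obtain ⟨d, rfl⟩ := Nat.exists_eq_add_of_le' h
        rw [deltaSum_add_period hst hsig htau]
        exact ih d (by have := NeZero.pos s; omega)
  have h1 := hle (k + m)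
  unfold deltaSum at h1
  rw [show k + m + 1 = k + 1 + m by ring, Finset.sum_range_add] at h1
  have h2 : ∀ n, cls s t x (n + 1) = (((k + 1 + n) * t : ℕ) : ZMod s) := by
    intro n
    unfold cls
    push_cast
    rw [hxk']
    push_cast
    ring
  simp only [h2]
  linarith

/-- No partition with the given cores has smaller `t`-weight than the peak weight. -/
theorem card_ge_of_mem_withCores {s t : ℕ} [NeZero s] (hst : Nat.Coprime s t)
    {sig tau lam : YoungDiagram} (htau : IsCore s tau) (x : ℤ)
    (h : lam ∈ withCores s t sig tau) :
    (tau.card : ℤ) + t * peakWeight s t sig tau x ≤ lam.card := by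
  obtain ⟨h1, -, w, hw⟩ := h
  have h2 := hw.moment_le (s := s) hst x
  have h3 : moment s t x lam = moment s t x sig := by
    unfold moment
    simp only [((hasCore_iff (NeZero.pos s)).1 h1).2]
  rw [peakWeight_eq_moment (NeZero.pos s) h1.1 htau, hw.card_eq]
  push_cast
  gcongr
  linarith

/-- The peak condition gives the nonnegative partial sums needed to move beads of `tau` until its
`s`-charges become those of `sig`; the moment is then that of `sig`. -/
theorem exists_mem_withCores_card_eq {s t : ℕ} [NeZero s] (ht : 0 < t) (hst : Nat.Coprime s t)
    {sig tau : YoungDiagram} (hsig : IsSTCore s t sig) (htau : IsSTCore s t tau) {x : ℤ}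
    (hx : IsPeak s t sig tau x) :
    ∃ lam ∈ withCores s t sig tau,
      (lam.card : ℤ) = tau.card + t * peakWeight s t sig tau x := by
  have hs := NeZero.pos s
  obtain ⟨lam, h1, h2, h3⟩ := exists_charge_eq ht hst x hsig.2 tau (by
    intro k _
    have h4 := hx.sum_delta_nonpos hst hsig.1 htau.1 k
    simp only [← charge_sub_charge_eq_delta hs hsig.1 htau.1] at h4
    rw [Finset.sum_sub_distrib] at h4 ⊢
    linarith)
  refine ⟨lam, ⟨(hasCore_iff hs).2 ⟨hsig.1, h2⟩, (hasCore_iff ht).2 ⟨htau.2, h1⟩⟩, ?_⟩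
  have h5 : moment s t x lam = moment s t x sig := by
    unfold moment
    simp only [h2]
  rw [peakWeight_eq_moment hs hsig.1 htau.1, ← h5]
  linarith

end CoreTheory

theorem proposition3p11 (s t : ℕ) (hs : 1 < s) (ht : 1 < t) (hst : Nat.Coprime s t)
    (sig tau : YoungDiagram) (hsig : CoreTheory.IsSTCore s t sig)
    (htau : CoreTheory.IsSTCore s t tau) (x : ℤ) (hx : CoreTheory.IsPeak s t sig tau x) :
    (CoreTheory.minimalPartitions s t sig tau).Nonempty ∧
    (∀ lam ∈ CoreTheory.minimalPartitions s t sig tau,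
      (∀ w : ℕ, CoreTheory.HasWeight t lam w ↔
        (w : ℤ) = CoreTheory.peakWeight s t sig tau x) ∧
      (∃ w : ℕ, CoreTheory.HasWeight t lam w) ∧
      lam.card = CoreTheory.minimalSize s t sig tau) ∧
    (CoreTheory.minimalSize s t sig tau : ℤ) =
      (tau.card : ℤ) + (t : ℤ) * CoreTheory.peakWeight s t sig tau x := by
  have : NeZero s := ⟨by omega⟩
  have ht0 : 0 < t := by omega
  obtain ⟨lam0, hmem, hcard⟩ := CoreTheory.exists_mem_withCores_card_eq ht0 hst hsig htau hx
  have hlow : ∀ mu ∈ CoreTheory.withCores s t sig tau, lam0.card ≤ mu.card := by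
    intro mu hmu
    have := CoreTheory.card_ge_of_mem_withCores hst htau.1 x hmu
    omega
  have hsize : CoreTheory.minimalSize s t sig tau = lam0.card := by
    unfold CoreTheory.minimalSize
    refine le_antisymm (Nat.sInf_le ⟨lam0, hmem, rfl⟩) (le_csInf ⟨_, lam0, hmem, rfl⟩ ?_)
    rintro _ ⟨mu, hmu, rfl⟩
    exact hlow mu hmu
  refine ⟨⟨lam0, hmem, hlow⟩, fun lam hlam => ?_, by rw [hsize, hcard]⟩
  have heq : lam.card = lam0.card := le_antisymm (hlam.2 _ hmem) (hlow _ hlam.1)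
  refine ⟨fun w => ?_, ?_, by rw [heq, hsize]⟩
  · have ht1 : (t : ℤ) ≠ 0 := by omega
    rw [CoreTheory.hasWeight_iff ht0 hlam.1.2, ← mul_right_inj' ht1, ← @Nat.cast_inj ℤ, heq, hcard]
    push_cast
    constructor <;> intro h <;> linarith
  · obtain ⟨w, hw⟩ := hlam.1.2.2
    exact ⟨w, tau, htau.2, hw⟩
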